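/- For $\rho:\mathbb{R}\to\mathbb{R}$ and $m,k\in\mathbb{N}$, let $\mathscr{L}_\rho(\mathbb{R}^m,\mathbb{R}^k)$ be the set of maps $\mathbf{x}\mapsto\rho(\mathbf{W}\mathbf{x}+\mathbf{b})$ with $\mathbf{W}\in\mathbb{R}^{k\times m}$, $\mathbf{b}\in\mathbb{R}^k$ and $\rho$ applied componentwise. Let $\mathscr{N}_\rho(\mathbb{R}^m,\mathbb{R}^k)$ be the set of all compositions $f_{l+1}\circ f_l\circ\dots\circ f_1$ with $l\ge1$, $n_0=m$, $n_1,\dots,n_l\in\mathbb{N}$ arbitrary, $f_i\in\mathscr{L}_\rho(\mathbb{R}^{n_{i-1}},\mathbb{R}^{n_i})$ for $i=1,\dots,l$, and $f_{l+1}:\mathbb{R}^{n_l}\to\mathbb{R}^k$ affine. Theorem. Let $\boldsymbol{\mu}$ be a random vector in $\mathbb{R}^p$, let $V\cong\mathbb{R}^{N_h}$ be a real normed space of finite dimension $N_h$, with norm $\|\cdot\|$, identified with $\mathbb{R}^{N_h}$ by a linear isomorphism (which defines the network classes $\mathscr{N}_\rho(V,\mathbb{R}^n)$ and $\mathscr{N}_\rho(\mathbb{R}^n,V)$),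 let $\mathcal{G}:\mathbb{R}^p\to V$ be measurable, and set $\mathbf{u}_{\boldsymbol{\mu}}:=\mathcal{G}(\boldsymbol{\mu})$. Let $n\in\mathbb{N}$, and let $\mathcal{M}(X,Y)$ denote the set of all measurable maps $X\to Y$. If $\mathbb{E}\|\mathbf{u}_{\boldsymbol{\mu}}\|<+\infty$, then $$\inf_{\substack{\Psi'\in\mathcal{M}(V,\mathbb{R}^n)\\ \Psi\in\mathcal{M}(\mathbb{R}^n,V)}}\mathbb{E}\|\mathbf{u}_{\boldsymbol{\mu}}-\Psi(\Psi'(\mathbf{u}_{\boldsymbol{\mu}}))\|=\inf_{\substack{\hat\Psi'\in\mathscr{N}_\rho(V,\mathbb{R}^n)\\ \hat\Psi\in\mathscr{N}_\rho(\mathbb{R}^n,V)}}\mathbb{E}\|\mathbf{u}_{\boldsymbol{\mu}}-\hat\Psi(\hat\Psi'(\mathbf{u}_{\boldsymbol{\mu}}))\|$$ (expectations taken in $[0,+\infty]$) for every Lipschitz continuous $\rho:\mathbb{R}\to\mathbb{R}$ that satisfies at least one of the following: (i) $\rho$ is bounded and nonconstant; (ii) $\rho$ is bounded from below and $\rho(x)\to+\infty$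 as $x\to+\infty$; (iii) there exist $a,b\in\mathbb{R}$ such that $x\mapsto a\rho(x)+b\rho(-x)$ satisfies (ii). -/

import Mathlib

open MeasureTheory Filter
open scoped ENNReal

namespace DeepAutoencoder

/-- The layers `x ↦ ρ (W x + b)` from `ℝᵐ` to `ℝᵏ`, with `ρ` acting on each entry. -/
def layers (ρ : ℝ → ℝ) (m k : ℕ) : Set ((Fin m → ℝ) → (Fin k → ℝ)) :=
  {f | ∃ (W : Matrix (Fin k) (Fin m) ℝ) (b : Fin k → ℝ),
    ∀ x i, f x i = ρ ((W.mulVec x + b) i)}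

/-- `HiddenStack ρ m k h`: the map `h` is a composition `f_l ∘ ⋯ ∘ f_1` of `l ≥ 1` layers
with activation `ρ`, starting in `ℝᵐ` and ending in `ℝᵏ`, with arbitrary intermediate widths. -/
inductive HiddenStack (ρ : ℝ → ℝ) (m : ℕ) : (k : ℕ) → ((Fin m → ℝ) → (Fin k → ℝ)) → Prop
  | first {k : ℕ} {f : (Fin m → ℝ) → (Fin k → ℝ)} (hf : f ∈ layers ρ m k) :
      HiddenStack ρ m k f
  | next {k k' : ℕ} {h : (Fin m → ℝ) → (Fin k → ℝ)} {f : (Fin k → ℝ) → (Fin k' → ℝ)}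
      (hh : HiddenStack ρ m k h) (hf : f ∈ layers ρ k k') : HiddenStack ρ m k' (f ∘ h)

/-- Deep neural networks from `ℝᵐ` to `ℝᵏ` with activation `ρ`: at least one hidden layer,
followed by a terminal layer without activation. -/
def networks (ρ : ℝ → ℝ) (m k : ℕ) : Set ((Fin m → ℝ) → (Fin k → ℝ)) :=
  {f | ∃ (j : ℕ) (h : (Fin m → ℝ) → (Fin j → ℝ)) (g : (Fin j → ℝ) → (Fin k → ℝ)),
    HiddenStack ρ m j h ∧ g ∈ layers id j k ∧ f = g ∘ h}

/-- Network encoders `V → ℝⁿ`, where `V` is identified with `ℝᴺ` by the linear isomorphism `e`.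
Since the first layer contains an arbitrary affine map, the class does not depend on `e`. -/
def encoderNetworks {V : Type*} [AddCommGroup V] [Module ℝ V] {N : ℕ}
    (e : V ≃ₗ[ℝ] (Fin N → ℝ)) (ρ : ℝ → ℝ) (n : ℕ) : Set (V → (Fin n → ℝ)) :=
  {F | ∃ f ∈ networks ρ N n, ∀ v, F v = f (e v)}

/-- Network decoders `ℝⁿ → V`, where `V` is identified with `ℝᴺ` by the linear isomorphism `e`.
Since the last layer is an arbitrary affine map, the class does not depend on `e`. -/
def decoderNetworks {V : Type*} [AddCommGroup V] [Module ℝ V] {N : ℕ}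
    (e : V ≃ₗ[ℝ] (Fin N → ℝ)) (ρ : ℝ → ℝ) (n : ℕ) : Set ((Fin n → ℝ) → V) :=
  {F | ∃ f ∈ networks ρ n N, ∀ c, F c = e.symm (f c)}

/-- `ρ` is bounded from below and `ρ x → +∞` as `x → +∞`. -/
def LowerBoundedDivergent (ρ : ℝ → ℝ) : Prop :=
  (∃ A : ℝ, ∀ x, A ≤ ρ x) ∧ Tendsto ρ atTop atTop

/-- The hypotheses on the activation: `ρ` is continuous and one of the following holds:
(i) `ρ` is bounded and nonconstant; (ii) `ρ` is bounded from below and diverges to `+∞` at `+∞`;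
(iii) for some `a`, `b`, the map `x ↦ a ρ(x) + b ρ(-x)` satisfies (ii). -/
def AdmissibleActivation (ρ : ℝ → ℝ) : Prop :=
  Continuous ρ ∧
    (((∃ C : ℝ, ∀ x, |ρ x| ≤ C) ∧ ∃ x y, ρ x ≠ ρ y) ∨
      LowerBoundedDivergent ρ ∨
      ∃ a b : ℝ, LowerBoundedDivergent (fun x => a * ρ x + b * ρ (-x)))

/-- The expected reconstruction error `𝔼 ‖u - Ψ (Ψ' u)‖`, with values in `[0, +∞]`. -/
noncomputable def reconstructionError {Ω V : Type*} [MeasurableSpace Ω] [NormedAddCommGroup V]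
    {n : ℕ} (P : Measure Ω) (u : Ω → V) (Ψ' : V → (Fin n → ℝ)) (Ψ : (Fin n → ℝ) → V) : ℝ≥0∞ :=
  ∫⁻ ω, ‖u ω - Ψ (Ψ' (u ω))‖ₑ ∂P

end DeepAutoencoder

/-! For `n ≥ 1` a simple function `φ` that is `L¹`-close to the identity factors through `ℝⁿ`, since
its finitely many values can be numbered; hence the network infimum is 0. For `n = 0` every decoder
is constant. Both cases reduce to imitating a simple `φ` by networks, given a code `c` injective on
its values: a network decoder nearly recovers each value from its code, and because it is Lipschitz
the encoder need only approximate `c ∘ φ` in `L¹` of the law of `u`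
(`exists_networks_reconstructionError_le`).

This rests on `L¹` approximation of simple functions by networks of growing depth. Riemann sums of
translates of `ρ` converge to a C¹ function `σ` with derivative `τ = ρ(· + δ) - ρ`. Differentiating
`σ(f + r g)` at `r = 0` puts `τ(f) g` in the closure one layer deeper
(`difference_mul_mem_l1Closure`). So the bounded functions `τ(w·x + b)` multiply the closure over
all depths into itself. Such multipliers form an algebra closed under bounded pointwise limits, and
the sets whose indicators are multipliers form a σ-algebra. If `τ` is nonconstant, countably many
`τ(w·x + b)` separate points, so this σ-algebra contains every Borel set
(`borel_le_multiplierSets`); multiplying the constant 1 yields all simple functions. Conditions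
(i)–(iii) serve only to exclude affine `ρ`, which makes some `τ` nonconstant. -/

namespace DeepAutoencoder

open scoped Topology NNReal

/-! ### Scalar networks and shared hidden layers -/

/-- The real-valued functions on `ℝᵐ` computed by networks with `d` hidden layers, written as
linear combinations of the units of the last layer (affine functions if `d = 0`). -/
def scalarNets (ρ : ℝ → ℝ) (m : ℕ) : ℕ → Submodule ℝ ((Fin m → ℝ) → ℝ)
  | 0 =>
    { carrier := {f | ∃ (w : Fin m → ℝ) (b : ℝ), ∀ x, f x = w ⬝ᵥ x + b}
      add_mem' := by
        rintro f g ⟨w, b, hf⟩ ⟨w', b', hg⟩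
        refine ⟨w + w', b + b', fun x => ?_⟩
        simp only [Pi.add_apply, hf, hg, add_dotProduct]
        ring
      zero_mem' := ⟨0, 0, fun x => by simp⟩
      smul_mem' := by
        rintro c f ⟨w, b, hf⟩
        refine ⟨c • w, c * b, fun x => ?_⟩
        simp only [Pi.smul_apply, hf, smul_dotProduct, smul_eq_mul]
        ring }
  | d + 1 => Submodule.span ℝ ((fun f => ρ ∘ f) '' (scalarNets ρ m d : Set _))

variable {ρ : ℝ → ℝ} {m : ℕ}

lemma affine_mem_scalarNets_zero (w : Fin m → ℝ) (b : ℝ) :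
    (fun x => w ⬝ᵥ x + b) ∈ scalarNets ρ m 0 := ⟨w, b, fun _ => rfl⟩

lemma comp_mem_scalarNets {d : ℕ} {f : (Fin m → ℝ) → ℝ} (hf : f ∈ scalarNets ρ m d) :
    ρ ∘ f ∈ scalarNets ρ m (d + 1) :=
  Submodule.subset_span ⟨f, hf, rfl⟩

lemma const_mem_scalarNets (hρ : ∃ a, ρ a ≠ 0) (d : ℕ) (c : ℝ) :
    (fun _ => c) ∈ scalarNets ρ m d := by
  induction d generalizing c with
  | zero => exact ⟨0, c, fun x => by simp⟩
  | succ d ih =>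
    obtain ⟨a, ha⟩ := hρ
    -- The span carries no bias term, so the constant comes from a unit with constant input `a`.
    have := (scalarNets ρ m (d + 1)).smul_mem (c / ρ a) (comp_mem_scalarNets (ih a))
    convert this using 1
    ext x
    simp [ha]

lemma exists_lipschitzWith_of_mem_scalarNets (hρ : ∃ K, LipschitzWith K ρ) {d : ℕ}
    {f : (Fin m → ℝ) → ℝ} (hf : f ∈ scalarNets ρ m d) : ∃ K, LipschitzWith K f := by
  obtain ⟨K, hK⟩ := hρ
  induction d generalizing f with
  | zero =>
    obtain ⟨w, b, hf⟩ := hf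
    let T : (Fin m → ℝ) →L[ℝ] ℝ := LinearMap.toContinuousLinearMap (dotProductBilin ℝ ℝ w)
    refine ⟨‖T‖₊, LipschitzWith.of_dist_le_mul fun x y => ?_⟩
    have := T.lipschitz.dist_le_mul x y
    simpa [hf, T, Real.dist_eq] using this
  | succ d ih =>
    refine Submodule.span_induction ?_ ?_ ?_ ?_ hf
    · rintro _ ⟨g, hg, rfl⟩
      obtain ⟨L, hL⟩ := ih hg
      exact ⟨K * L, hK.comp hL⟩
    · exact ⟨0, LipschitzWith.const 0⟩
    · rintro f g - - ⟨L, hL⟩ ⟨L', hL'⟩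
      exact ⟨L + L', hL.add hL'⟩
    · rintro c f - ⟨L, hL⟩
      exact ⟨‖c‖₊ * L, (lipschitzWith_smul c).comp hL⟩

/-- All units occurring in all the `f i` are placed side by side in one last layer, indexed by a
sigma type; row `i` of `W` reads only the block of `f i`. The hypothesis `H` isolates how that layer
is built, which differs between `d = 0` and `d > 0`. -/
lemma exists_hiddenStack_of_layer {d : ℕ}
    (H : ∀ (κ : Type) [Fintype κ] (q : κ → (Fin m → ℝ) → ℝ), (∀ k, q k ∈ scalarNets ρ m d) →
      ∃ (j : ℕ) (h : (Fin m → ℝ) → (Fin j → ℝ)), HiddenStack ρ m j h ∧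
        ∃ eq : κ ≃ Fin j, ∀ x k, h x (eq k) = ρ (q k x))
    {ι : Type} [Fintype ι] (f : ι → (Fin m → ℝ) → ℝ) (hf : ∀ i, f i ∈ scalarNets ρ m (d + 1)) :
    ∃ (j : ℕ) (h : (Fin m → ℝ) → (Fin j → ℝ)) (W : Matrix ι (Fin j) ℝ),
      HiddenStack ρ m j h ∧ ∀ x i, f i x = (W.mulVec (h x)) i := by
  classical
  choose n c g hg using fun i => Submodule.mem_span_set'.1 (hf i)
  choose q hq hqg using fun i l => (g i l).2
  obtain ⟨j, h, hh, eq, heq⟩ := H (Σ i, Fin (n i)) (fun k => q k.1 k.2) (fun k => hq k.1 k.2)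
  refine ⟨j, h, Matrix.of fun i k =>
    if (eq.symm k).1 = i then c (eq.symm k).1 (eq.symm k).2 else 0, hh, fun x i => ?_⟩
  rw [← hg i]
  simp only [Matrix.mulVec, dotProduct, Matrix.of_apply]
  rw [← Equiv.sum_comp eq]
  simp only [Equiv.symm_apply_apply, heq, Fintype.sum_sigma, ← hqg, Finset.sum_apply]
  rw [Fintype.sum_eq_single i fun i' hi' => by simp [hi']]
  refine Finset.sum_congr rfl fun l _ => ?_
  rw [eq.symm_apply_apply]
  simp

/-- Finitely many scalar networks of the same depth share a common stack of hidden layers. -/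
lemma exists_hiddenStack_of_mem_scalarNets (d : ℕ) {ι : Type} [Fintype ι]
    (f : ι → (Fin m → ℝ) → ℝ) (hf : ∀ i, f i ∈ scalarNets ρ m (d + 1)) :
    ∃ (j : ℕ) (h : (Fin m → ℝ) → (Fin j → ℝ)) (W : Matrix ι (Fin j) ℝ),
      HiddenStack ρ m j h ∧ ∀ x i, f i x = (W.mulVec (h x)) i := by
  classical
  induction d generalizing ι with
  | zero =>
    refine exists_hiddenStack_of_layer (fun κ _ q hq => ?_) f hf
    choose w b hwb using hq
    exact ⟨_, _, .first ⟨Matrix.of fun k => w ((Fintype.equivFin κ).symm k),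
      fun k => b ((Fintype.equivFin κ).symm k), fun _ _ => rfl⟩, Fintype.equivFin κ,
      fun x k => by simp [hwb, Matrix.mulVec]⟩
  | succ d ih =>
    refine exists_hiddenStack_of_layer (fun κ _ q hq => ?_) f hf
    obtain ⟨j, h, W, hh, hW⟩ := ih q hq
    exact ⟨_, _, .next hh ⟨Matrix.of fun k => W ((Fintype.equivFin κ).symm k), 0,
      fun _ _ => rfl⟩, Fintype.equivFin κ, fun x k => by simp [hW, Matrix.mulVec]⟩

/-! ### `L¹` closures and their multipliers -/

/-- The functions approximable in `L¹(ν)` by integrable elements of `A`. -/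
def l1Closure {X : Type*} [MeasurableSpace X] (ν : Measure X) (A : Submodule ℝ (X → ℝ)) :
    Submodule ℝ (X → ℝ) where
  carrier := {f | Integrable f ν ∧
    ∀ ε > 0, ∃ g ∈ A, Integrable g ν ∧ ∫ x, |f x - g x| ∂ν < ε}
  add_mem' := by
    rintro f f' ⟨hf, hfA⟩ ⟨hf', hfA'⟩
    refine ⟨hf.add hf', fun ε hε => ?_⟩
    obtain ⟨g, hg, hgi, hgε⟩ := hfA (ε / 2) (by positivity)
    obtain ⟨g', hg', hgi', hgε'⟩ := hfA' (ε / 2) (by positivity)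
    refine ⟨g + g', A.add_mem hg hg', hgi.add hgi', ?_⟩
    calc ∫ x, |(f + f') x - (g + g') x| ∂ν
        ≤ ∫ x, (|f x - g x| + |f' x - g' x|) ∂ν := by
          refine integral_mono ((hf.add hf').sub (hgi.add hgi')).abs
            ((hf.sub hgi).abs.add (hf'.sub hgi').abs) fun x => ?_
          simp only [Pi.add_apply]
          rw [add_sub_add_comm]
          exact abs_add_le _ _
      _ = _ := integral_add (hf.sub hgi).abs (hf'.sub hgi').abs
      _ < ε := by linarith
  zero_mem' := ⟨integrable_zero _ _ _, fun ε hε =>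
    ⟨0, A.zero_mem, integrable_zero _ _ _, by simpa using hε⟩⟩
  smul_mem' := by
    rintro c f ⟨hf, hfA⟩
    refine ⟨hf.smul c, fun ε hε => ?_⟩
    obtain ⟨g, hg, hgi, hgε⟩ := hfA (ε / (|c| + 1)) (by positivity)
    refine ⟨c • g, A.smul_mem c hg, hgi.smul c, ?_⟩
    have h0 : 0 ≤ ∫ x, |f x - g x| ∂ν := integral_nonneg fun _ => abs_nonneg _
    rw [lt_div_iff₀ (by positivity)] at hgε
    calc ∫ x, |(c • f) x - (c • g) x| ∂ν = |c| * ∫ x, |f x - g x| ∂ν := by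
          rw [← integral_const_mul]
          simp [← mul_sub, abs_mul]
      _ < ε := by nlinarith

section L1Closure

variable {X : Type*} [MeasurableSpace X] {ν : Measure X} {A : Submodule ℝ (X → ℝ)} {f : X → ℝ}

lemma le_l1Closure (h : ∀ f ∈ A, Integrable f ν) : A ≤ l1Closure ν A :=
  fun f hf => ⟨h f hf, fun ε hε => ⟨f, hf, h f hf, by simpa using hε⟩⟩

lemma mem_l1Closure_of_approx (hf : Integrable f ν)
    (h : ∀ ε > 0, ∃ g ∈ l1Closure ν A, ∫ x, |f x - g x| ∂ν < ε) : f ∈ l1Closure ν A := by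
  refine ⟨hf, fun ε hε => ?_⟩
  obtain ⟨g, hg, hgε⟩ := h (ε / 2) (by positivity)
  obtain ⟨g', hg', hgi', hgε'⟩ := hg.2 (ε / 2) (by positivity)
  refine ⟨g', hg', hgi', ?_⟩
  calc ∫ x, |f x - g' x| ∂ν ≤ ∫ x, (|f x - g x| + |g x - g' x|) ∂ν :=
        integral_mono (hf.sub hgi').abs ((hf.sub hg.1).abs.add (hg.1.sub hgi').abs)
          fun x => abs_sub_le _ _ _
    _ = _ := integral_add (hf.sub hg.1).abs (hg.1.sub hgi').abs
    _ < ε := by linarith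

lemma mem_l1Closure_of_tendsto {F : ℕ → X → ℝ} (hF : ∀ n, F n ∈ l1Closure ν A)
    {bound : X → ℝ} (hb : Integrable bound ν) (hFb : ∀ n x, |F n x| ≤ bound x)
    (hlim : ∀ x, Tendsto (fun n => F n x) atTop (𝓝 (f x))) : f ∈ l1Closure ν A := by
  have hfm : AEStronglyMeasurable f ν :=
    aestronglyMeasurable_of_tendsto_ae atTop (fun n => (hF n).1.1) (ae_of_all _ hlim)
  have hfb : ∀ x, |f x| ≤ bound x := fun x =>
    le_of_tendsto (hlim x).abs (Eventually.of_forall fun n => hFb n x)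
  have hf : Integrable f ν := hb.mono' hfm (ae_of_all _ hfb)
  refine mem_l1Closure_of_approx hf fun ε hε => ?_
  have ht : Tendsto (fun n => ∫ x, |f x - F n x| ∂ν) atTop (𝓝 (∫ _, (0 : ℝ) ∂ν)) := by
    refine tendsto_integral_of_dominated_convergence (fun x => 2 * bound x)
      (fun n => (hf.sub (hF n).1).abs.1) (hb.const_mul 2) (fun n => ae_of_all _ fun x => ?_)
      (ae_of_all _ fun x => ?_)
    · rw [Real.norm_eq_abs, abs_abs]
      linarith [abs_sub (f x) (F n x), hfb x, hFb n x]
    · simpa using ((tendsto_const_nhds (x := f x)).sub (hlim x)).abs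
  rw [integral_zero] at ht
  obtain ⟨n, hn⟩ := (ht.eventually_lt_const hε).exists
  exact ⟨F n, hF n, hn⟩

/-- The bounded functions that map the `L¹(ν)`-closure of `A` into itself by multiplication. -/
def multipliers (ν : Measure X) (A : Submodule ℝ (X → ℝ)) : Subalgebra ℝ (X → ℝ) where
  carrier := {q | (∃ C, ∀ x, |q x| ≤ C) ∧ ∀ g ∈ l1Closure ν A, q * g ∈ l1Closure ν A}
  mul_mem' := by
    rintro q r ⟨⟨C, hC⟩, hq⟩ ⟨⟨D, hD⟩, hr⟩
    refine ⟨⟨C * D, fun x => ?_⟩, fun g hg => ?_⟩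
    · rw [Pi.mul_apply, abs_mul]
      exact mul_le_mul (hC x) (hD x) (abs_nonneg _) ((abs_nonneg _).trans (hC x))
    · rw [mul_assoc]
      exact hq _ (hr _ hg)
  add_mem' := by
    rintro q r ⟨⟨C, hC⟩, hq⟩ ⟨⟨D, hD⟩, hr⟩
    refine ⟨⟨C + D, fun x => (abs_add_le _ _).trans (add_le_add (hC x) (hD x))⟩,
      fun g hg => ?_⟩
    rw [add_mul]
    exact Submodule.add_mem _ (hq _ hg) (hr _ hg)
  algebraMap_mem' := by
    intro c
    refine ⟨⟨|c|, fun x => le_rfl⟩, fun g hg => ?_⟩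
    exact (l1Closure ν A).smul_mem c hg

/-- Dominated convergence, with `C * |g|` dominating the products with `g`. -/
lemma mem_multipliers_of_tendsto {F : ℕ → X → ℝ} {q : X → ℝ} (hF : ∀ n, F n ∈ multipliers ν A)
    {C : ℝ} (hC : ∀ n x, |F n x| ≤ C)
    (hlim : ∀ x, Tendsto (fun n => F n x) atTop (𝓝 (q x))) : q ∈ multipliers ν A := by
  refine ⟨⟨C, fun x => le_of_tendsto (hlim x).abs (Eventually.of_forall fun n => hC n x)⟩,
    fun g hg => ?_⟩
  refine mem_l1Closure_of_tendsto (fun n => (hF n).2 g hg) (hg.1.abs.const_mul C)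
    (fun n x => ?_) fun x => (hlim x).mul_const (g x)
  rw [Pi.mul_apply, abs_mul]
  exact mul_le_mul_of_nonneg_right (hC n x) (abs_nonneg _)

/-- Weierstrass on `[-C, C]`, which contains the values of `q`: polynomials in `q` are multipliers
because multipliers form an algebra. -/
lemma continuous_comp_mem_multipliers {q : X → ℝ} (hq : q ∈ multipliers ν A) {F : ℝ → ℝ}
    (hF : Continuous F) : F ∘ q ∈ multipliers ν A := by
  obtain ⟨C, hC⟩ := hq.1
  have hmem : ∀ x, q x ∈ Set.Icc (-C) C := fun x => abs_le.1 (hC x)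
  choose p hp using fun n : ℕ => exists_polynomial_near_of_continuousOn (-C) C F
    hF.continuousOn (1 / ((n : ℝ) + 1)) (by positivity)
  obtain ⟨D, hD⟩ := isCompact_Icc.exists_bound_of_continuousOn
    (hF.continuousOn (s := Set.Icc (-C) C))
  have key : ∀ n x, Polynomial.aeval q (p n) x = (p n).eval (q x) := fun n x => by
    rw [← Polynomial.coe_aeval_eq_eval]
    exact (Polynomial.aeval_algHom_apply (Pi.evalAlgHom ℝ (fun _ : X => ℝ) x) q (p n)).symm
  refine mem_multipliers_of_tendsto (F := fun n => Polynomial.aeval q (p n)) (C := D + 1)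
    (fun n => Algebra.adjoin_singleton_le hq (Polynomial.aeval_mem_adjoin_singleton ℝ q)) (fun n x => ?_) (fun x => ?_)
  · rw [key]
    have h1 := hp n (q x) (hmem x)
    have h2 : 1 / ((n : ℝ) + 1) ≤ 1 := by
      rw [div_le_one (by positivity)]
      linarith [n.cast_nonneg (α := ℝ)]
    have h3 := hD (q x) (hmem x)
    rw [Real.norm_eq_abs] at h3
    linarith [abs_sub_abs_le_abs_sub ((p n).eval (q x)) (F (q x))]
  · simp only [key]
    rw [tendsto_iff_dist_tendsto_zero]
    refine squeeze_zero (fun _ => dist_nonneg) (fun n => ?_)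
      tendsto_one_div_add_atTop_nhds_zero_nat
    exact (hp n (q x) (hmem x)).le

lemma indicator_lt_mem_multipliers {q : X → ℝ} (hq : q ∈ multipliers ν A) (c : ℝ) :
    Set.indicator {x | c < q x} 1 ∈ multipliers ν A := by
  -- Continuous ramps in `q` increase to the indicator.
  refine mem_multipliers_of_tendsto (F := fun (n : ℕ) => (fun y => min 1 (n * max (y - c) 0)) ∘ q)
    (C := 1) (fun n => continuous_comp_mem_multipliers hq (by fun_prop)) (fun n x => ?_)
    (fun x => ?_)
  · simp only [Function.comp_apply]
    rw [abs_of_nonneg (by positivity)]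
    exact min_le_left _ _
  · simp only [Function.comp_apply]
    by_cases hx : c < q x
    · have h0 : 0 < q x - c := sub_pos.2 hx
      rw [Set.indicator_of_mem (by exact hx), Pi.one_apply]
      refine tendsto_const_nhds.congr' ?_
      have ht : Tendsto (fun n : ℕ => (n : ℝ) * (q x - c)) atTop atTop :=
        tendsto_natCast_atTop_atTop.atTop_mul_const h0
      filter_upwards [ht.eventually_ge_atTop 1] with n hn
      rw [max_eq_left h0.le, min_eq_left hn]
    · rw [Set.indicator_of_notMem (by exact hx), max_eq_right (by linarith)]
      simp

/-- The sets whose indicator function is a multiplier. -/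
@[reducible] def multiplierSets (ν : Measure X) (A : Submodule ℝ (X → ℝ)) : MeasurableSpace X where
  MeasurableSet' s := s.indicator 1 ∈ multipliers ν A
  measurableSet_empty := by
    rw [Set.indicator_empty]
    exact Subalgebra.zero_mem _
  measurableSet_compl s hs := by
    rw [Set.indicator_compl]
    exact Subalgebra.sub_mem _ (Subalgebra.one_mem _) hs
  measurableSet_iUnion s hs := by
    have hfin : ∀ n : ℕ, (⋃ i < n, s i).indicator (1 : X → ℝ) ∈ multipliers ν A := by
      intro n
      induction n with
      | zero => 
        simp only [not_lt_zero, Set.iUnion_of_empty, Set.iUnion_empty, Set.indicator_empty]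
        exact (multipliers ν A).zero_mem
      | succ n ih =>
        -- Inclusion–exclusion turns finite unions into algebra operations; the countable union is
        -- then a bounded pointwise limit.
        have : (⋃ i < n + 1, s i).indicator (1 : X → ℝ) =
            (⋃ i < n, s i).indicator 1 + (s n).indicator 1
              - (⋃ i < n, s i).indicator 1 * (s n).indicator 1 := by
          rw [Set.biUnion_lt_succ]
          have h := Set.indicator_union_add_inter (1 : X → ℝ) (⋃ i < n, s i) (s n)
          rw [← Set.inter_indicator_one, ← h]
          simp
        rw [this]
        exact Subalgebra.sub_mem _ (Subalgebra.add_mem _ ih (hs n))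
          (Subalgebra.mul_mem _ ih (hs n))
    refine mem_multipliers_of_tendsto hfin (C := 1) (fun n x => ?_) (fun x => ?_)
    · by_cases hx : x ∈ ⋃ i < n, s i <;> simp [Set.indicator, hx]
    · refine tendsto_const_nhds.congr' ?_
      by_cases hx : x ∈ ⋃ i, s i
      · obtain ⟨i, hi⟩ := Set.mem_iUnion.1 hx
        filter_upwards [eventually_gt_atTop i] with n hn
        have hx' : x ∈ ⋃ i < n, s i := Set.mem_iUnion₂.2 ⟨i, hn, hi⟩
        rw [Set.indicator_of_mem hx, Set.indicator_of_mem hx']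
      · refine Eventually.of_forall fun n => ?_
        have hx' : x ∉ ⋃ i < n, s i := fun h => hx (Set.iUnion₂_subset_iUnion _ _ h)
        simp only [Set.indicator_of_notMem hx, Set.indicator_of_notMem hx']

lemma measurable_of_mem_multipliers {q : X → ℝ} (hq : q ∈ multipliers ν A) :
    Measurable[multiplierSets ν A] q :=
  @measurable_of_Ioi _ _ _ _ _ (multiplierSets ν A) _ _ _ _ fun c =>
    indicator_lt_mem_multipliers hq c

end L1Closure

/-! ### Admissible activations are not affine -/

lemma not_lowerBoundedDivergent_affine (a b : ℝ) :
    ¬ LowerBoundedDivergent (fun x => a * x + b) := by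
  rintro ⟨⟨A, hA⟩, ht⟩
  rcases eq_or_ne a 0 with rfl | ha
  · simp only [zero_mul, zero_add] at ht
    exact not_tendsto_const_atTop _ _ ht
  · have := hA ((A - b - 1) / a)
    simp only [mul_div_cancel₀ _ ha] at this
    linarith

/-- An admissible activation is not affine, so one of its difference functions is nonconstant. -/
lemma AdmissibleActivation.exists_difference_ne {ρ : ℝ → ℝ} (hρ : AdmissibleActivation ρ) :
    ∃ δ s t, ρ (s + δ) - ρ s ≠ ρ (t + δ) - ρ t := by
  by_contra! h
  obtain ⟨hcont, hρ⟩ := hρ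
  -- If every difference function is constant, `ρ - ρ 0` is additive; continuity then makes it
  -- linear.
  let φ : ℝ →+ ℝ :=
    { toFun := fun x => ρ x - ρ 0
      map_zero' := sub_self _
      map_add' := fun x y => by
        have := h y x 0
        rw [zero_add] at this
        linarith }
  have hφ : Continuous φ := hcont.sub continuous_const
  have haff : ∀ x, ρ x = φ 1 * x + ρ 0 := fun x => by
    have h1 := map_real_smul φ hφ x 1
    have h2 : φ x = ρ x - ρ 0 := rfl
    simp only [smul_eq_mul, mul_one] at h1
    linarith
  generalize φ 1 = a at haff
  generalize ρ 0 = b at haff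
  obtain rfl : ρ = fun x => a * x + b := funext haff
  rcases hρ with ⟨⟨C, hC⟩, x, y, hxy⟩ | hρ | ⟨c, d, hcd⟩
  · rcases eq_or_ne a 0 with rfl | ha
    · simp at hxy
    · have := (abs_le.1 (hC ((C - b + 1) / a))).2
      simp only [mul_div_cancel₀ _ ha] at this
      linarith
  · exact not_lowerBoundedDivergent_affine a b hρ
  · refine not_lowerBoundedDivergent_affine ((c - d) * a) ((c + d) * b) ?_
    convert hcd using 2
    ring

/-! ### Smoothing the activation -/

/-- The unnormalized moving average of `ρ` over a window of length `δ`. -/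
noncomputable def movingIntegral (ρ : ℝ → ℝ) (δ x : ℝ) : ℝ := ∫ t in x..x + δ, ρ t

section MovingIntegral

variable {ρ : ℝ → ℝ} {K : ℝ≥0}

lemma hasDerivAt_movingIntegral (hρ : Continuous ρ) (δ x : ℝ) :
    HasDerivAt (movingIntegral ρ δ) (ρ (x + δ) - ρ x) x := by
  have hint : ∀ a b : ℝ, IntervalIntegrable ρ volume a b := fun a b => hρ.intervalIntegrable a b
  have h : ∀ y, HasDerivAt (fun u => ∫ t in (0 : ℝ)..u, ρ t) (ρ y) y := fun y =>
    intervalIntegral.integral_hasDerivAt_right (hint _ _)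
      hρ.stronglyMeasurable.stronglyMeasurableAtFilter hρ.continuousAt
  have h' := ((h (x + δ)).comp_add_const x δ).sub (h x)
  have heq : movingIntegral ρ δ =
      fun y => (∫ t in (0 : ℝ)..y + δ, ρ t) - ∫ t in (0 : ℝ)..y, ρ t := funext fun y =>
    (intervalIntegral.integral_interval_sub_left (hint _ _) (hint _ _)).symm
  rw [heq]
  exact h'

lemma abs_difference_le (hρ : LipschitzWith K ρ) (δ x : ℝ) : |ρ (x + δ) - ρ x| ≤ K * |δ| := by
  have := hρ.dist_le_mul (x + δ) x
  simpa [Real.dist_eq] using this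

lemma abs_movingIntegral_sub_le (hρ : LipschitzWith K ρ) (δ x y : ℝ) :
    |movingIntegral ρ δ x - movingIntegral ρ δ y| ≤ K * |δ| * |x - y| := by
  have h := fun z => hasDerivAt_movingIntegral hρ.continuous δ z
  have hL : LipschitzWith (K * ‖δ‖₊) (movingIntegral ρ δ) :=
    lipschitzWith_of_nnnorm_deriv_le (fun z => (h z).differentiableAt) fun z => by
      rw [(h z).deriv, ← NNReal.coe_le_coe]
      simpa using abs_difference_le hρ δ z
  simpa [Real.dist_eq] using hL.dist_le_mul x y

/-- Each of the `n + 1` cells has length `|η|`, and `ρ` varies by at most `K * |η|` on it. The bound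
is uniform in `x`, and `δ` may be negative. -/
lemma abs_riemannSum_sub_movingIntegral_le (hρ : LipschitzWith K ρ) (δ x : ℝ) (n : ℕ) :
    |∑ k ∈ Finset.range (n + 1), δ / (n + 1) * ρ (x + k * (δ / (n + 1))) - movingIntegral ρ δ x|
      ≤ K * δ ^ 2 * (1 / ((n : ℝ) + 1)) := by
  have hn : (0 : ℝ) < n + 1 := by positivity
  set η := δ / (n + 1) with hη
  have hint : ∀ a b : ℝ, IntervalIntegrable ρ volume a b := fun a b =>
    hρ.continuous.intervalIntegrable a b
  have hsum : movingIntegral ρ δ x =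
      ∑ k ∈ Finset.range (n + 1), ∫ t in (x + k * η)..(x + (k + 1 : ℕ) * η), ρ t := by
    rw [intervalIntegral.sum_integral_adjacent_intervals (a := fun k : ℕ => x + k * η)
      fun k _ => hint _ _]
    simp only [movingIntegral, Nat.cast_zero, zero_mul, add_zero, hη]
    congr 2
    push_cast
    field_simp
  rw [hsum, ← Finset.sum_sub_distrib]
  calc _ ≤ ∑ k ∈ Finset.range (n + 1), K * |η| * |η| := by
        refine (Finset.abs_sum_le_sum_abs _ _).trans (Finset.sum_le_sum fun k _ => ?_)
        have h1 : η * ρ (x + k * η) = ∫ _ in (x + k * η)..(x + (k + 1 : ℕ) * η),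
            ρ (x + k * η) := by
          rw [intervalIntegral.integral_const, smul_eq_mul]
          push_cast
          ring
        rw [h1, ← intervalIntegral.integral_sub (by simp) (hint _ _)]
        have h2 : (x + (k + 1 : ℕ) * η) - (x + k * η) = η := by
          push_cast
          ring
        have h3 := intervalIntegral.norm_integral_le_of_norm_le_const
          (a := x + k * η) (b := x + (k + 1 : ℕ) * η) (C := K * |η|)
          (f := fun t => ρ (x + k * η) - ρ t) fun t ht => ?_
        · rwa [h2, Real.norm_eq_abs] at h3
        · have h4 := hρ.dist_le_mul (x + k * η) t
          rw [Real.dist_eq, Real.dist_eq] at h4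
          refine h4.trans (mul_le_mul_of_nonneg_left ?_ K.2)
          have h5 := Set.abs_sub_left_of_mem_uIcc (Set.uIoc_subset_uIcc ht)
          rwa [h2, abs_sub_comm] at h5
    _ = K * δ ^ 2 * (1 / ((n : ℝ) + 1)) := by
        rw [Finset.sum_const, Finset.card_range, nsmul_eq_mul, mul_assoc (K : ℝ),
          abs_mul_abs_self, hη]
        push_cast
        field_simp

end MovingIntegral

/-! ### `L¹` approximation by scalar networks -/

section Closure

variable {ρ : ℝ → ℝ} {K : ℝ≥0} {m : ℕ} {ν : Measure (Fin m → ℝ)} [IsFiniteMeasure ν]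

lemma integrable_of_lipschitzWith {E : Type*} [NormedAddCommGroup E] [MeasurableSpace E]
    [BorelSpace E] [SecondCountableTopology E] {ν : Measure E} [IsFiniteMeasure ν]
    (hν : Integrable (fun x => ‖x‖) ν) {f : E → ℝ} {L : ℝ≥0}
    (hf : LipschitzWith L f) : Integrable f ν := by
  refine ((hν.const_mul L).add (integrable_const |f 0|)).mono'
    hf.continuous.aestronglyMeasurable (ae_of_all _ fun x => ?_)
  have := hf.dist_le_mul x 0
  rw [Real.dist_eq, dist_zero_right] at this
  have h2 := abs_sub_abs_le_abs_sub (f x) (f 0)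
  simp only [Real.norm_eq_abs, Pi.add_apply]
  linarith

lemma integrable_lipschitz_comp {X : Type*} [MeasurableSpace X] {ν : Measure X}
    [IsFiniteMeasure ν] {f : X → ℝ} (hf : Integrable f ν) {σ : ℝ → ℝ} (hσ : Continuous σ) {L : ℝ}
    (hL : ∀ x y, |σ x - σ y| ≤ L * |x - y|) : Integrable (fun x => σ (f x)) ν := by
  refine ((hf.abs.const_mul L).add (integrable_const |σ 0|)).mono'
    (hσ.comp_aestronglyMeasurable hf.1) (ae_of_all _ fun x => ?_)
  have := hL (f x) 0
  rw [sub_zero] at this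
  have h2 := abs_sub_abs_le_abs_sub (σ (f x)) (σ 0)
  simp only [Real.norm_eq_abs, Pi.add_apply]
  linarith

variable (hρ : LipschitzWith K ρ) {d : ℕ} {f g : (Fin m → ℝ) → ℝ}
include hρ

lemma comp_mem_l1Closure_scalarNets (hf : f ∈ l1Closure ν (scalarNets ρ m d)) :
    (fun x => ρ (f x)) ∈ l1Closure ν (scalarNets ρ m (d + 1)) := by
  have hL : ∀ x y, |ρ x - ρ y| ≤ K * |x - y| := fun x y => by
    simpa [Real.dist_eq] using hρ.dist_le_mul x y
  have hint := fun {u : (Fin m → ℝ) → ℝ} (hu : Integrable u ν) =>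
    integrable_lipschitz_comp hu hρ.continuous hL
  refine ⟨hint hf.1, fun ε hε => ?_⟩
  obtain ⟨g, hg, hgi, hgε⟩ := hf.2 (ε / (K + 1)) (by positivity)
  rw [lt_div_iff₀ (by positivity)] at hgε
  have h0 : 0 ≤ ∫ x, |f x - g x| ∂ν := integral_nonneg fun _ => abs_nonneg _
  refine ⟨_, comp_mem_scalarNets hg, hint hgi, ?_⟩
  calc ∫ x, |ρ (f x) - ρ (g x)| ∂ν ≤ ∫ x, K * |f x - g x| ∂ν :=
        integral_mono ((hint hf.1).sub (hint hgi)).abs ((hf.1.sub hgi).abs.const_mul _)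
          fun x => hL _ _
    _ = K * ∫ x, |f x - g x| ∂ν := integral_const_mul _ _
    _ < ε := by nlinarith

/-- The Riemann sums are linear combinations of the units `ρ (f + const)` and converge uniformly. -/
lemma movingIntegral_comp_mem_l1Closure (hρ0 : ∃ a, ρ a ≠ 0) (δ : ℝ)
    (hf : f ∈ l1Closure ν (scalarNets ρ m d)) :
    (fun x => movingIntegral ρ δ (f x)) ∈ l1Closure ν (scalarNets ρ m (d + 1)) := by
  have hint : Integrable (fun x => movingIntegral ρ δ (f x)) ν :=
    integrable_lipschitz_comp hf.1 (continuous_iff_continuousAt.2 fun x =>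
      (hasDerivAt_movingIntegral hρ.continuous δ x).continuousAt)
      (abs_movingIntegral_sub_le hρ δ)
  have happ := fun x n => abs_riemannSum_sub_movingIntegral_le hρ δ (f x) n
  refine mem_l1Closure_of_tendsto (F := fun n x =>
    ∑ k ∈ Finset.range (n + 1), δ / (n + 1) * ρ (f x + k * (δ / (n + 1))))
    (fun n => ?_) (hint.abs.add (integrable_const (K * δ ^ 2))) (fun n x => ?_) (fun x => ?_)
  · have : (fun x => ∑ k ∈ Finset.range (n + 1), δ / (n + 1) * ρ (f x + k * (δ / (n + 1)))) =
        ∑ k ∈ Finset.range (n + 1), (δ / (n + 1)) • fun x => ρ (f x + k * (δ / (n + 1))) := by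
      ext x
      simp
    rw [this]
    refine Submodule.sum_mem _ fun k _ => Submodule.smul_mem _ _ ?_
    refine comp_mem_l1Closure_scalarNets hρ (Submodule.add_mem _ hf ?_)
    exact ⟨integrable_const _, fun ε hε =>
      ⟨_, const_mem_scalarNets hρ0 d (k * (δ / (n + 1))), integrable_const _, by simpa using hε⟩⟩
  · have h1 := happ x n
    have h2 : 1 / ((n : ℝ) + 1) ≤ 1 := by
      rw [div_le_one (by positivity)]
      linarith [n.cast_nonneg (α := ℝ)]
    have h3 : K * δ ^ 2 * (1 / ((n : ℝ) + 1)) ≤ K * δ ^ 2 * 1 :=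
      mul_le_mul_of_nonneg_left h2 (by positivity)
    have h4 := (abs_sub_abs_le_abs_sub _ _).trans h1
    simp only [Pi.add_apply]
    linarith
  · rw [tendsto_iff_dist_tendsto_zero]
    refine squeeze_zero (fun _ => dist_nonneg) (fun n => happ x n) ?_
    simpa using tendsto_one_div_add_atTop_nhds_zero_nat.const_mul ((K : ℝ) * δ ^ 2)

/-- The product is the derivative of `σ (f + r g)` at `r = 0`. Since `σ` has Lipschitz constant `K *
|δ|`, the difference quotients are dominated by `K * |δ| * |g|`. -/
lemma difference_mul_mem_l1Closure (hρ0 : ∃ a, ρ a ≠ 0) (δ : ℝ)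
    (hf : f ∈ l1Closure ν (scalarNets ρ m d)) (hg : g ∈ l1Closure ν (scalarNets ρ m d)) :
    (fun x => (ρ (f x + δ) - ρ (f x)) * g x) ∈ l1Closure ν (scalarNets ρ m (d + 1)) := by
  set σ := movingIntegral ρ δ
  refine mem_l1Closure_of_tendsto (F := fun n x =>
    ((1 / ((n : ℝ) + 1))⁻¹) * (σ (f x + 1 / ((n : ℝ) + 1) * g x) - σ (f x)))
    (fun n => ?_) (hg.1.abs.const_mul (K * |δ|)) (fun n x => ?_) (fun x => ?_)
  · refine Submodule.smul_mem _ ((1 / ((n : ℝ) + 1))⁻¹) (Submodule.sub_mem _ ?_ ?_)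
    · exact movingIntegral_comp_mem_l1Closure hρ hρ0 δ
        (Submodule.add_mem _ hf (Submodule.smul_mem _ (1 / ((n : ℝ) + 1)) hg))
    · exact movingIntegral_comp_mem_l1Closure hρ hρ0 δ hf
  · have h := abs_movingIntegral_sub_le hρ δ (f x + 1 / ((n : ℝ) + 1) * g x) (f x)
    have hn : (0 : ℝ) < 1 / ((n : ℝ) + 1) := by positivity
    rw [add_sub_cancel_left, abs_mul, abs_of_pos hn] at h
    rw [abs_mul, abs_of_pos (inv_pos.2 hn), inv_mul_le_iff₀ hn]
    exact h.trans_eq (by ring)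
  · have hlin : HasDerivAt (fun t : ℝ => f x + t * g x) (g x) 0 := by
      simpa using ((hasDerivAt_id (0 : ℝ)).mul_const (g x)).const_add (f x)
    have hσ : HasDerivAt σ (ρ (f x + δ) - ρ (f x)) (f x + 0 * g x) := by
      simpa using hasDerivAt_movingIntegral hρ.continuous δ (f x)
    have h := (hσ.comp (0 : ℝ) hlin).tendsto_slope_zero
    have ht : Tendsto (fun n : ℕ => 1 / ((n : ℝ) + 1)) atTop (𝓝[≠] 0) :=
      tendsto_nhdsWithin_iff.2 ⟨tendsto_one_div_add_atTop_nhds_zero_nat,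
        Eventually.of_forall fun n => by
          have : (0 : ℝ) < 1 / ((n : ℝ) + 1) := by positivity
          exact this.ne'⟩
    simpa [Function.comp_def] using h.comp ht

variable {δ s t : ℝ} (hst : ρ (s + δ) - ρ s ≠ ρ (t + δ) - ρ t)
include hst

omit hρ in
lemma exists_ne_zero_of_difference_ne : ∃ a, ρ a ≠ 0 := by
  by_contra! h
  simp [h] at hst

omit hρ in
lemma const_mem_l1Closure_scalarNets (d : ℕ) (c : ℝ) :
    (fun _ => c) ∈ l1Closure ν (scalarNets ρ m d) :=
  ⟨integrable_const _, fun ε hε =>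
    ⟨_, const_mem_scalarNets (exists_ne_zero_of_difference_ne hst) d c, integrable_const _,
      by simpa using hε⟩⟩

/-- With `f` a constant `a` at which the difference function does not vanish, the product lemma
returns a nonzero multiple of `g` one layer deeper. -/
lemma monotone_l1Closure_scalarNets : Monotone fun d => l1Closure ν (scalarNets ρ m d) := by
  refine monotone_nat_of_le_succ fun d g hg => ?_
  obtain ⟨a, ha⟩ : ∃ a, ρ (a + δ) - ρ a ≠ 0 := by
    by_contra! h
    simp [h] at hst
  have h := difference_mul_mem_l1Closure hρ (exists_ne_zero_of_difference_ne hst) δ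
    (const_mem_l1Closure_scalarNets hst d a) hg
  have h' := Submodule.smul_mem _ (ρ (a + δ) - ρ a)⁻¹ h
  convert h' using 1
  ext x
  simp [inv_mul_cancel_left₀ ha]

lemma mem_iSup_l1Closure_iff : f ∈ (⨆ d, l1Closure ν (scalarNets ρ m d)) ↔
    ∃ d, f ∈ l1Closure ν (scalarNets ρ m d) :=
  Submodule.mem_iSup_of_directed _ (monotone_l1Closure_scalarNets hρ hst).directed_le

/-- Allowing every depth beyond `d₀` lets finitely many coordinates share one depth later. -/
lemma exists_scalarNet_of_mem_l1Closure
    (hf : f ∈ l1Closure ν (⨆ d, l1Closure ν (scalarNets ρ m d))) {ε : ℝ} (hε : 0 < ε) :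
    ∃ d₀, ∀ d ≥ d₀, ∃ g ∈ scalarNets ρ m d, Integrable g ν ∧ ∫ x, |f x - g x| ∂ν < ε := by
  obtain ⟨g, hg, hgi, hgε⟩ := hf.2 (ε / 2) (by positivity)
  obtain ⟨d₀, hd₀⟩ := (mem_iSup_l1Closure_iff hρ hst).1 hg
  refine ⟨d₀, fun d hd => ?_⟩
  have hgd := monotone_l1Closure_scalarNets hρ hst hd hd₀
  obtain ⟨g', hg', hgi', hgε'⟩ := hgd.2 (ε / 2) (by positivity)
  refine ⟨g', hg', hgi', ?_⟩
  calc ∫ x, |f x - g' x| ∂ν ≤ ∫ x, (|f x - g x| + |g x - g' x|) ∂ν :=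
        integral_mono (hf.1.sub hgi').abs ((hf.1.sub hgi).abs.add (hgi.sub hgi').abs)
          fun x => abs_sub_le _ _ _
    _ = _ := integral_add (hf.1.sub hgi).abs (hgi.sub hgi').abs
    _ < ε := by linarith

/-- The product lemma costs one layer, which the supremum over depths absorbs; boundedness of the
factor extends the claim from that supremum to its `L¹` closure. -/
lemma difference_affine_mem_multipliers (hν : Integrable (fun x => ‖x‖) ν)
    (w : Fin m → ℝ) (b : ℝ) :
    (fun x => ρ (w ⬝ᵥ x + b + δ) - ρ (w ⬝ᵥ x + b)) ∈
      multipliers ν (⨆ d, l1Closure ν (scalarNets ρ m d)) := by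
  have haff : (fun x => w ⬝ᵥ x + b) ∈ l1Closure ν (scalarNets ρ m 0) := by
    obtain ⟨L, hL⟩ := exists_lipschitzWith_of_mem_scalarNets ⟨K, hρ⟩
      (affine_mem_scalarNets_zero (ρ := ρ) w b)
    have := integrable_of_lipschitzWith hν hL
    exact ⟨this, fun ε hε => ⟨_, affine_mem_scalarNets_zero w b, this, by simpa using hε⟩⟩
  have hbd := fun x : Fin m → ℝ => abs_difference_le hρ δ (w ⬝ᵥ x + b)
  have hcont : Continuous fun x : Fin m → ℝ => ρ (w ⬝ᵥ x + b + δ) - ρ (w ⬝ᵥ x + b) := by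
    have := hρ.continuous
    have h2 : Continuous fun x : Fin m → ℝ => w ⬝ᵥ x := continuous_const.dotProduct continuous_id
    fun_prop
  refine ⟨⟨K * |δ|, hbd⟩, fun g hg => ?_⟩
  have hmul : ∀ {u : (Fin m → ℝ) → ℝ}, Integrable u ν →
      Integrable (fun x => (ρ (w ⬝ᵥ x + b + δ) - ρ (w ⬝ᵥ x + b)) * u x) ν := fun hu =>
    hu.bdd_mul hcont.aestronglyMeasurable (ae_of_all _ hbd)
  refine ⟨hmul hg.1, fun ε hε => ?_⟩
  obtain ⟨g', hg', hgi', hgε'⟩ := hg.2 (ε / (K * |δ| + 1)) (by positivity)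
  rw [lt_div_iff₀ (by positivity)] at hgε'
  obtain ⟨d, hd⟩ := (mem_iSup_l1Closure_iff hρ hst).1 hg'
  refine ⟨_, (mem_iSup_l1Closure_iff hρ hst).2 ⟨d + 1, difference_mul_mem_l1Closure hρ
    (exists_ne_zero_of_difference_ne hst) δ
    (monotone_l1Closure_scalarNets hρ hst (Nat.zero_le d) haff) hd⟩, hmul hgi', ?_⟩
  have h0 : 0 ≤ ∫ x, |g x - g' x| ∂ν := integral_nonneg fun _ => abs_nonneg _
  calc _ ≤ ∫ x, K * |δ| * |g x - g' x| ∂ν := by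
        refine integral_mono ((hmul hg.1).sub (hmul hgi')).abs
          ((hg.1.sub hgi').abs.const_mul _) fun x => ?_
        simp only [Pi.mul_apply, ← mul_sub, abs_mul]
        exact mul_le_mul_of_nonneg_right (hbd x) (abs_nonneg _)
    _ = K * |δ| * ∫ x, |g x - g' x| ∂ν := integral_const_mul _ _
    _ < ε := by nlinarith

/-- By the Lusin–Souslin theorem, the continuous injection `Φ` maps Borel sets to Borel sets, so
each Borel set is a preimage under `Φ`, whose coordinates are multipliers. -/
lemma borel_le_multiplierSets (hν : Integrable (fun x => ‖x‖) ν) :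
    (inferInstance : MeasurableSpace (Fin m → ℝ)) ≤
      multiplierSets ν (⨆ d, l1Closure ν (scalarNets ρ m d)) := by
  let c : ℕ → ℝ × ℝ := TopologicalSpace.denseSeq (ℝ × ℝ)
  let τ : ℝ → ℝ := fun y => ρ (y + δ) - ρ y
  have hτ : Continuous τ := by
    have := hρ.continuous
    fun_prop
  let Φ : (Fin m → ℝ) → (Fin m × ℕ → ℝ) := fun x k =>
    τ (Pi.single k.1 (c k.2).1 ⬝ᵥ x + (c k.2).2)
  have hΦc : Continuous Φ := by
    refine continuous_pi fun k => hτ.comp ?_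
    have h2 : Continuous fun x : Fin m → ℝ => (Pi.single k.1 (c k.2).1 : Fin m → ℝ) ⬝ᵥ x :=
      continuous_const.dotProduct continuous_id
    fun_prop
  have hΦi : Function.Injective Φ := by
    intro x y hxy
    by_contra hne
    obtain ⟨i, hi⟩ := Function.ne_iff.1 hne
    let U : Set (ℝ × ℝ) := {p | τ (p.1 * x i + p.2) ≠ τ (p.1 * y i + p.2)}
    have hU : IsOpen U := isOpen_ne_fun (by fun_prop) (by fun_prop)
    have hne' : x i - y i ≠ 0 := sub_ne_zero.2 hi
    have hU' : U.Nonempty := by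
      -- The pair `(w, b)` solving `w * x i + b = s` and `w * y i + b = t`; since `U` is open, the
      -- dense sequence also meets it.
      refine ⟨((s - t) / (x i - y i), s - (s - t) / (x i - y i) * x i), ?_⟩
      have h1 : (s - t) / (x i - y i) * y i + (s - (s - t) / (x i - y i) * x i) = t := by
        field_simp
        ring
      change τ _ ≠ τ _
      simp only [h1, add_sub_cancel]
      exact hst
    obtain ⟨k, hk⟩ := (TopologicalSpace.denseRange_denseSeq (ℝ × ℝ)).exists_mem_open hU hU'
    refine hk ?_
    have := congrFun hxy (i, k)
    simpa [Φ, c] using this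
  have hΦe : MeasurableEmbedding Φ := hΦc.measurableEmbedding hΦi
  have hΦm : Measurable[multiplierSets ν (⨆ d, l1Closure ν (scalarNets ρ m d))] Φ :=
    @measurable_pi_lambda _ _ _ (multiplierSets ν _) _ _ fun k => measurable_of_mem_multipliers
      (difference_affine_mem_multipliers hρ hst hν (Pi.single k.1 (c k.2).1) (c k.2).2)
  intro B hB
  have := hΦm (hΦe.measurableSet_image.2 hB)
  rwa [Set.preimage_image_eq _ hΦi] at this

/-- Simple functions are approximable in `L¹(ν)` by networks of any sufficiently large depth. -/
lemma exists_scalarNet_approx_simpleFunc (hν : Integrable (fun x => ‖x‖) ν)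
    (φ : SimpleFunc (Fin m → ℝ) ℝ) {ε : ℝ} (hε : 0 < ε) :
    ∃ d₀, ∀ d ≥ d₀, ∃ g ∈ scalarNets ρ m d, Integrable g ν ∧ ∫ x, |φ x - g x| ∂ν < ε := by
  refine exists_scalarNet_of_mem_l1Closure hρ hst ?_ hε
  have hone : (fun _ => 1) ∈ l1Closure ν (⨆ d, l1Closure ν (scalarNets ρ m d)) :=
    le_l1Closure (fun f hf => ((mem_iSup_l1Closure_iff hρ hst).1 hf).choose_spec.1)
      ((mem_iSup_l1Closure_iff hρ hst).2 ⟨0, const_mem_l1Closure_scalarNets hst 0 1⟩)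
  induction φ using SimpleFunc.induction with
  | @const c B hs =>
    have h := Submodule.smul_mem _ c ((borel_le_multiplierSets hρ hst hν _ hs).2 _ hone)
    convert h using 1
    ext x
    by_cases hx : x ∈ B <;> simp [hx]
  | add _ hf hg => exact Submodule.add_mem _ hf hg

end Closure

/-! ### From scalar networks to vector-valued ones -/

lemma continuous_of_mem_layers {ρ : ℝ → ℝ} (hρ : Continuous ρ) {m k : ℕ}
    {f : (Fin m → ℝ) → (Fin k → ℝ)} (hf : f ∈ layers ρ m k) : Continuous f := by
  obtain ⟨W, b, hf⟩ := hf
  refine continuous_pi fun i => ?_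
  simp only [hf]
  have h : Continuous fun x : Fin m → ℝ => W.mulVec x :=
    continuous_const.matrix_mulVec continuous_id
  exact hρ.comp (((continuous_apply i).comp h).add continuous_const)

lemma HiddenStack.continuous {ρ : ℝ → ℝ} (hρ : Continuous ρ) {m k : ℕ}
    {f : (Fin m → ℝ) → (Fin k → ℝ)} (hf : HiddenStack ρ m k f) : Continuous f := by
  induction hf with
  | first hf => exact continuous_of_mem_layers hρ hf
  | next _ hf ih => exact (continuous_of_mem_layers hρ hf).comp ih

lemma continuous_of_mem_networks {ρ : ℝ → ℝ} (hρ : Continuous ρ) {m k : ℕ}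
    {f : (Fin m → ℝ) → (Fin k → ℝ)} (hf : f ∈ networks ρ m k) : Continuous f := by
  obtain ⟨j, h, g, hh, hg, rfl⟩ := hf
  exact (continuous_of_mem_layers continuous_id hg).comp (hh.continuous hρ)

lemma mem_networks_of_scalarNets {ρ : ℝ → ℝ} {m k d : ℕ} {f : Fin k → (Fin m → ℝ) → ℝ}
    (hf : ∀ i, f i ∈ scalarNets ρ m (d + 1)) : (fun x i => f i x) ∈ networks ρ m k := by
  obtain ⟨j, h, W, hh, hW⟩ := exists_hiddenStack_of_mem_scalarNets d f hf
  refine ⟨j, h, fun y => W.mulVec y, hh, ⟨W, 0, fun y i => by simp⟩, ?_⟩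
  ext x i
  exact hW x i

lemma exists_common_depth {k : ℕ} {p : Fin k → ℕ → Prop} (h : ∀ i, ∃ d₀, ∀ d ≥ d₀, p i d) :
    ∃ d, ∀ i, p i (d + 1) := by
  choose d₀ hd₀ using h
  exact ⟨Finset.univ.sup d₀, fun i =>
    hd₀ i _ ((Finset.le_sup (Finset.mem_univ i)).trans (Nat.le_succ _))⟩

/-! ### Network decoders and encoders -/

section Approximation

variable {ρ : ℝ → ℝ} {K : ℝ≥0} (hρ : LipschitzWith K ρ) {δ s t : ℝ}
  (hst : ρ (s + δ) - ρ s ≠ ρ (t + δ) - ρ t)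
include hρ hst

/-- For a sum of Dirac masses at the codes, a small `L¹` error is a small error at every code.
Injectivity of `c` lets the targets be values of a simple function. -/
lemma exists_scalarNet_approx_on_finset {α : Type*} {m : ℕ} (R : Finset α)
    {c : α → Fin m → ℝ} (hc : Set.InjOn c R) (y : α → ℝ) {ε : ℝ} (hε : 0 < ε) :
    ∃ d₀, ∀ d ≥ d₀, ∃ g ∈ scalarNets ρ m d, ∀ v ∈ R, |y v - g (c v)| < ε := by
  classical
  let ν : Measure (Fin m → ℝ) := ∑ v ∈ R, Measure.dirac (c v)
  have hνf : IsFiniteMeasure ν := ⟨by simp [ν]⟩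
  have hν : Integrable (fun x => ‖x‖) ν :=
    integrable_finsetSum_measure.2 fun v _ => integrable_dirac (by simp)
  let _ : MeasurableSpace R := ⊤
  have hemb : MeasurableEmbedding fun v : R => c v :=
    { injective := fun v w h => Subtype.ext (hc v.2 w.2 h)
      measurable := measurable_from_top
      measurableSet_image' := fun B _ => (B.toFinite.image _).measurableSet }
  let φ : SimpleFunc (Fin m → ℝ) ℝ :=
    (SimpleFunc.ofFinite fun v : R => y v).extend _ hemb 0
  have hφ : ∀ v ∈ R, φ (c v) = y v := fun v hv =>
    SimpleFunc.extend_apply (SimpleFunc.ofFinite fun v : R => y v) hemb 0 ⟨v, hv⟩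
  obtain ⟨d₀, hd₀⟩ := exists_scalarNet_approx_simpleFunc hρ hst hν φ hε
  refine ⟨d₀, fun d hd => ?_⟩
  obtain ⟨g, hg, -, hgε⟩ := hd₀ d hd
  refine ⟨g, hg, fun v hv => ?_⟩
  rw [integral_finsetSum_measure fun v _ => integrable_dirac (by simp)] at hgε
  simp only [integral_dirac] at hgε
  have := Finset.single_le_sum (f := fun v => |φ (c v) - g (c v)|)
    (fun _ _ => abs_nonneg _) hv
  simp only [hφ v hv] at this
  exact this.trans_lt hgε

variable {V : Type*} [NormedAddCommGroup V] [NormedSpace ℝ V] {N n : ℕ}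
  (e : V ≃ₗ[ℝ] (Fin N → ℝ))

lemma exists_lipschitz_decoderNetwork (R : Finset V) {c : V → Fin n → ℝ} (hc : Set.InjOn c R)
    {ε : ℝ} (hε : 0 < ε) :
    ∃ Ψ ∈ decoderNetworks e ρ n, (∃ L, LipschitzWith L Ψ) ∧ ∀ v ∈ R, ‖v - Ψ (c v)‖ ≤ ε := by
  let T : (Fin N → ℝ) →L[ℝ] V := LinearMap.toContinuousLinearMap e.symm.toLinearMap
  obtain ⟨d, hd⟩ := exists_common_depth fun i => exists_scalarNet_approx_on_finset hρ hst R hc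
    (fun v => e v i) (ε := ε / (‖T‖ + 1)) (by positivity)
  choose g hg hgε using hd
  choose L hL using fun i => exists_lipschitzWith_of_mem_scalarNets ⟨K, hρ⟩ (hg i)
  refine ⟨fun y => T fun i => g i y, ⟨_, mem_networks_of_scalarNets hg, fun _ => rfl⟩,
    ⟨‖T‖₊ * ∑ i, L i, T.lipschitz.comp ?_⟩, fun v hv => ?_⟩
  · refine LipschitzWith.of_dist_le_mul fun y z => (dist_pi_le_iff (by positivity)).2 fun i => ?_
    refine ((hL i).dist_le_mul y z).trans (mul_le_mul_of_nonneg_right ?_ dist_nonneg)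
    exact_mod_cast Finset.single_le_sum (f := L) (fun _ _ => zero_le) (Finset.mem_univ i)
  · have hv' : v = T (e v) := (e.symm_apply_apply v).symm
    calc ‖v - T fun i => g i (c v)‖ = ‖T (e v - fun i => g i (c v))‖ := by
          rw [map_sub, ← hv']
      _ ≤ ‖T‖ * ‖e v - fun i => g i (c v)‖ := T.le_opNorm _
      _ ≤ ‖T‖ * (ε / (‖T‖ + 1)) := by
          refine mul_le_mul_of_nonneg_left ?_ (norm_nonneg _)
          exact (pi_norm_le_iff_of_nonneg (by positivity)).2 fun i => (hgε i v hv).le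
      _ ≤ ε := by
          rw [mul_div_assoc', div_le_iff₀ (by positivity)]
          nlinarith [norm_nonneg T]

/-- If a simple function factors through an injective code, some networks reconstruct almost as
well as that function. -/
lemma exists_networks_reconstructionError_le [MeasurableSpace V] [BorelSpace V]
    {Ω : Type*} [MeasurableSpace Ω] {P : Measure Ω} [IsProbabilityMeasure P] {u : Ω → V} (hum : Measurable u) (hu : ∫⁻ ω, ‖u ω‖ₑ ∂P < ∞)
    (φ : SimpleFunc V V) {c : V → Fin n → ℝ} (hc : Set.InjOn c φ.range) {ε : ℝ} (hε : 0 < ε) :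
    ∃ Ψ' ∈ encoderNetworks e ρ n, ∃ Ψ ∈ decoderNetworks e ρ n,
      reconstructionError P u Ψ' Ψ ≤ ∫⁻ ω, ‖u ω - φ (u ω)‖ₑ ∂P + ENNReal.ofReal ε := by
  have : FiniteDimensional ℝ V := LinearEquiv.finiteDimensional e.symm
  have hui : Integrable u P :=
    ⟨(hum.stronglyMeasurable).aestronglyMeasurable, hu⟩
  let T : V →L[ℝ] (Fin N → ℝ) := LinearMap.toContinuousLinearMap e.toLinearMap
  let S : (Fin N → ℝ) →L[ℝ] V := LinearMap.toContinuousLinearMap e.symm.toLinearMap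
  have hST : ∀ v, S (T v) = v := e.symm_apply_apply
  obtain ⟨Ψ, hΨ, ⟨L, hL⟩, hΨε⟩ := exists_lipschitz_decoderNetwork hρ hst e φ.range hc
    (half_pos hε)
  have hTu : Measurable fun ω => T (u ω) := T.continuous.measurable.comp hum
  let ν : Measure (Fin N → ℝ) := P.map fun ω => T (u ω)
  have hνp : IsProbabilityMeasure ν := Measure.isProbabilityMeasure_map hTu.aemeasurable
  have hν : Integrable (fun x => ‖x‖) ν :=
    (integrable_map_measure continuous_norm.aestronglyMeasurable hTu.aemeasurable).2
      (T.integrable_comp hui).norm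
  -- Chosen so that `n` coordinate errors of size `η`, amplified by the decoder's constant `L`, cost
  -- at most `ε / 2`.
  let η := ε / (2 * (L * n + 1))
  have hη : 0 < η := by positivity
  obtain ⟨d, hd⟩ := exists_common_depth fun i : Fin n => exists_scalarNet_approx_simpleFunc hρ hst
    hν ((φ.comp S S.continuous.measurable).map fun v => c v i) hη
  choose g hg hgi hgε using hd
  have hψi : ∀ i, Integrable (fun x => |c (φ (S x)) i - g i x|) ν := fun i => by
    have h : Integrable ((φ.comp S S.continuous.measurable).map fun v => c v i) ν :=
      SimpleFunc.integrable_of_isFiniteMeasure _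
    exact (h.sub (hgi i)).abs
  have hψi' : ∀ i, Integrable (fun ω => |c (φ (u ω)) i - g i (T (u ω))|) P := fun i => by
    simpa [Function.comp_def, hST] using (hψi i).comp_measurable hTu
  have hψε : ∀ i, ∫ ω, |c (φ (u ω)) i - g i (T (u ω))| ∂P ≤ η := fun i => by
    have h := integral_map hTu.aemeasurable (hψi i).1
    simp only [hST] at h
    rw [← h]
    exact (hgε i).le
  refine ⟨fun v i => g i (T v), ⟨_, mem_networks_of_scalarNets hg, fun _ => rfl⟩, Ψ, hΨ, ?_⟩
  let b : Ω → ℝ := fun ω => ε / 2 + L * ∑ i, |c (φ (u ω)) i - g i (T (u ω))|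
  have hb0 : ∀ ω, 0 ≤ b ω := fun ω => by positivity
  have hbi : Integrable b P := (integrable_const _).add
    ((integrable_finsetSum _ fun i _ => hψi' i).const_mul _)
  have hbε : ∫ ω, b ω ∂P ≤ ε := by
    calc ∫ ω, b ω ∂P = ε / 2 + L * ∑ i, ∫ ω, |c (φ (u ω)) i - g i (T (u ω))| ∂P := by
          rw [integral_add (integrable_const _)
            ((integrable_finsetSum _ fun i _ => hψi' i).const_mul _), integral_const_mul,
            integral_finsetSum _ fun i _ => hψi' i]
          simp
      _ ≤ ε / 2 + L * ∑ _ : Fin n, η := by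
          gcongr with i
          exact hψε i
      _ ≤ ε := by
          have h1 : (L * n + 1) * η = ε / 2 := by
            simp only [η]
            field_simp
          simp only [Finset.sum_const, Finset.card_univ, Fintype.card_fin, nsmul_eq_mul]
          nlinarith
  -- The path runs from `u` through `φ u` and `Ψ (c (φ u))` to the network output: the decoder's
  -- error on exact codes is at most `ε / 2`, and its Lipschitz bound handles the encoder's error.
  have hpt : ∀ ω, ‖u ω - Ψ (fun i => g i (T (u ω)))‖ ≤ ‖u ω - φ (u ω)‖ + b ω := fun ω => by
    have h1 := hΨε (φ (u ω)) (SimpleFunc.mem_range_self _ _)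
    have h2 := hL.norm_sub_le (c (φ (u ω))) (fun i => g i (T (u ω)))
    have h3 : ‖c (φ (u ω)) - fun i => g i (T (u ω))‖ ≤
        ∑ i, |c (φ (u ω)) i - g i (T (u ω))| :=
      (pi_norm_le_iff_of_nonneg (Finset.sum_nonneg fun _ _ => abs_nonneg _)).2 fun i =>
        Finset.single_le_sum (f := fun i => |c (φ (u ω)) i - g i (T (u ω))|)
          (fun _ _ => abs_nonneg _) (Finset.mem_univ i)
    have h4 := mul_le_mul_of_nonneg_left h3 L.2
    have h5 := norm_sub_le_norm_sub_add_norm_sub (u ω) (φ (u ω)) (Ψ fun i => g i (T (u ω)))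
    have h6 := norm_sub_le_norm_sub_add_norm_sub (φ (u ω)) (Ψ (c (φ (u ω))))
      (Ψ fun i => g i (T (u ω)))
    change _ ≤ _ + (ε / 2 + L * _)
    change (L : ℝ) * _ ≤ (L : ℝ) * _ at h4
    linarith
  calc reconstructionError P u (fun v i => g i (T v)) Ψ
      ≤ ∫⁻ ω, (‖u ω - φ (u ω)‖ₑ + ENNReal.ofReal (b ω)) ∂P := by
        refine lintegral_mono fun ω => ?_
        rw [← ofReal_norm, ← ofReal_norm, ← ENNReal.ofReal_add (norm_nonneg _) (hb0 ω)]
        exact ENNReal.ofReal_le_ofReal (hpt ω)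
    _ = ∫⁻ ω, ‖u ω - φ (u ω)‖ₑ ∂P + ENNReal.ofReal (∫ ω, b ω ∂P) := by
        rw [lintegral_add_right' _ hbi.1.aemeasurable.ennreal_ofReal,
          ofReal_integral_eq_lintegral_ofReal hbi (ae_of_all _ hb0)]
    _ ≤ _ := by gcongr

end Approximation

end DeepAutoencoder

/-! ### The two infima agree -/

theorem theorem1 {Ω : Type*} [MeasurableSpace Ω] (P : Measure Ω) [IsProbabilityMeasure P]
    {V : Type*} [NormedAddCommGroup V] [NormedSpace ℝ V] [MeasurableSpace V] [BorelSpace V]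
    (p N n : ℕ) (e : V ≃ₗ[ℝ] (Fin N → ℝ))
    (μ : Ω → (Fin p → ℝ)) (hμ : Measurable μ)
    (G : (Fin p → ℝ) → V) (hG : Measurable G)
    (hu : ∫⁻ ω, ‖G (μ ω)‖ₑ ∂P < ∞)
    (ρ : ℝ → ℝ) (hLip : ∃ K, LipschitzWith K ρ)
    (hρ : DeepAutoencoder.AdmissibleActivation ρ) :
    (⨅ (Ψ' : V → (Fin n → ℝ)) (_ : Measurable Ψ') (Ψ : (Fin n → ℝ) → V) (_ : Measurable Ψ),
        DeepAutoencoder.reconstructionError P (fun ω => G (μ ω)) Ψ' Ψ) =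
      ⨅ (Ψ' ∈ DeepAutoencoder.encoderNetworks e ρ n)
        (Ψ ∈ DeepAutoencoder.decoderNetworks e ρ n),
        DeepAutoencoder.reconstructionError P (fun ω => G (μ ω)) Ψ' Ψ := by
  have : FiniteDimensional ℝ V := LinearEquiv.finiteDimensional e.symm
  have : ProperSpace V := FiniteDimensional.proper ℝ V
  have hum : Measurable fun ω => G (μ ω) := hG.comp hμ
  obtain ⟨K, hK⟩ := hLip
  apply le_antisymm
  · refine le_iInf₂ fun Ψ' hΨ' => le_iInf₂ fun Ψ hΨ => ?_
    obtain ⟨f', hf', hΨ'⟩ := hΨ'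
    obtain ⟨f, hf, hΨ⟩ := hΨ
    obtain rfl : Ψ' = fun v => f' (e v) := funext hΨ'
    obtain rfl : Ψ = fun c => e.symm (f c) := funext hΨ
    have hf'c := DeepAutoencoder.continuous_of_mem_networks hK.continuous hf'
    have hfc := DeepAutoencoder.continuous_of_mem_networks hK.continuous hf
    have hec : Continuous e := e.toLinearMap.continuous_of_finiteDimensional
    have hec' : Continuous e.symm := e.symm.toLinearMap.continuous_of_finiteDimensional
    exact iInf₂_le_of_le _ (hf'c.comp hec).measurable
      (iInf₂_le_of_le _ (hec'.comp hfc).measurable le_rfl)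
  · obtain ⟨δ, s, t, hst⟩ := hρ.exists_difference_ne
    refine le_iInf₂ fun Ψ' _ => le_iInf₂ fun Ψ _ => ?_
    have key : ∀ (φ : SimpleFunc V V) (c : V → Fin n → ℝ), Set.InjOn c φ.range → ∀ ε : ℝ, 0 < ε →
        (⨅ (Ψ' ∈ DeepAutoencoder.encoderNetworks e ρ n)
          (Ψ ∈ DeepAutoencoder.decoderNetworks e ρ n),
          DeepAutoencoder.reconstructionError P (fun ω => G (μ ω)) Ψ' Ψ) ≤
        ∫⁻ ω, ‖G (μ ω) - φ (G (μ ω))‖ₑ ∂P + ENNReal.ofReal ε := by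
      intro φ c hc ε hε
      obtain ⟨Φ', hΦ', Φ, hΦ, h⟩ :=
        DeepAutoencoder.exists_networks_reconstructionError_le hK hst e hum hu φ hc hε
      exact iInf₂_le_of_le Φ' hΦ' (iInf₂_le_of_le Φ hΦ h)
    refine ENNReal.le_of_forall_pos_le_add fun ε hε _ => ?_
    -- For `n = 0` the given `Ψ` is constant, hence itself a simple function of `u`, and the trivial
    -- code is injective on its single value.
    rcases Nat.eq_zero_or_pos n with rfl | hn
    · have h := key (SimpleFunc.const V (Ψ 0)) (fun _ => 0)
        (fun v hv w hw _ => by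
          obtain ⟨_, rfl⟩ := SimpleFunc.mem_range.1 hv
          obtain ⟨_, rfl⟩ := SimpleFunc.mem_range.1 hw
          rfl) ε hε
      have hΨ0 : ∀ y, Ψ y = Ψ 0 := fun y => by rw [Subsingleton.elim y 0]
      simpa [DeepAutoencoder.reconstructionError, hΨ0] using h
    -- For `n > 0` the given pair plays no role: the network infimum is below every `ε`.
    · have hid : Integrable (id : V → V) (P.map fun ω => G (μ ω)) :=
        (integrable_map_measure stronglyMeasurable_id.aestronglyMeasurable hum.aemeasurable).2
          ⟨hum.stronglyMeasurable.aestronglyMeasurable, hu⟩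
      have hlim := SimpleFunc.tendsto_approxOn_range_L1_enorm measurable_id hid
      have hε2 : (0 : ℝ≥0∞) < ENNReal.ofReal (ε / 2) := by simpa using hε
      obtain ⟨k, hk⟩ := (hlim.eventually_lt_const hε2).exists
      set φ := SimpleFunc.approxOn (id : V → V) measurable_id (Set.range id ∪ {0}) 0 (Or.inr rfl) k
      classical
      -- Every coordinate is the number of the value in `φ.range`; one coordinate already separates
      -- values, and it exists as `n > 0`.
      let c : V → Fin n → ℝ := fun v _ =>
        if h : v ∈ φ.range then ((φ.range.equivFin ⟨v, h⟩ : ℕ) : ℝ) else 0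
      have hc : Set.InjOn c φ.range := by
        intro v hv w hw hvw
        have h := congrFun hvw ⟨0, hn⟩
        simp only [c, dif_pos (Finset.mem_coe.1 hv), dif_pos (Finset.mem_coe.1 hw)] at h
        have h' := φ.range.equivFin.injective (Fin.ext (Nat.cast_injective h))
        exact congrArg Subtype.val h'
      refine (key φ c hc (ε / 2) (by positivity)).trans ?_
      have hφ : ∫⁻ ω, ‖G (μ ω) - φ (G (μ ω))‖ₑ ∂P ≤ ENNReal.ofReal (ε / 2) := by
        rw [lintegral_map (by fun_prop) hum] at hk
        exact (lintegral_congr fun ω => enorm_sub_rev _ _).trans_le hk.le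
      calc _ ≤ ENNReal.ofReal (ε / 2) + ENNReal.ofReal (ε / 2) := by gcongr
        _ = ε := by
          rw [← ENNReal.ofReal_add (by positivity) (by positivity), add_halves]
          simp
        _ ≤ _ := le_add_self
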